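/- Let $d\in\mathbb N$ and $a<b$ in $\mathbb R$. For a locally Lipschitz function $\phi:\mathbb R^d\to\mathbb R$ let $$\partial^*\phi(x)=\mathrm{Conv}\Big\{\lim_{i\to\infty}\nabla\phi(x_i)\ :\ x_i\to x,\ \phi\text{ differentiable at every }x_i,\ \text{the limit exists}\Big\}$$ denote its Clarke gradient at $x$, and for $A\subset\mathbb R^d$ let $\Delta(A)=\inf\{\|v\| : v\in A\}$, where $\|\cdot\|$ is the Euclidean norm. Let $\phi:\mathbb R^d\to\mathbb R$ be a locally Lipschitz function that is Lipschitz on $\overline{\phi^{-1}(a,b]}$, and let $\mu>0$ be such that $\Delta(\partial^*\phi(x))\ge\mu$ for all $x\in\phi^{-1}(a,b]$ (for instance $\mu=\inf\{\Delta(\partial^*\phi(x)) : x\in\phi^{-1}(a,b]\}$ if this infimum is positive and finite). Then for every $\varepsilon\in(0,\mu)$ there exists a continuous map $$C_\phi:[0,1]\times\phi^{-1}(-\infty,b]\to\phi^{-1}(-\infty,b]$$ such that 1. for all $0\le t<s\le 1$ and all $x\in\phi^{-1}(-\infty,b]$ with $C_\phi(s,x)\in\phi^{-1}(a,b]$, $$\phi(C_\phi(s,x))-\phi(C_\phi(t,x))\le-(s-t)(b-a);$$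 2. $C_\phi(t,x)=x$ for all $t\in[0,1]$ and $x\in\phi^{-1}(-\infty,a]$; 3. for every $x\in\phi^{-1}(-\infty,b]$ the map $s\mapsto C_\phi(s,x)$ is $\frac{b-a}{\mu-\varepsilon}$-Lipschitz on $[0,1]$; 4. $C_\phi$ is a strong deformation retraction of $\phi^{-1}(-\infty,b]$ onto $\phi^{-1}(-\infty,a]$: $C_\phi(0,x)=x$ and $\phi(C_\phi(1,x))\le a$ for all $x\in\phi^{-1}(-\infty,b]$, and $C_\phi(t,x)=x$ for all $t\in[0,1]$ and $x\in\phi^{-1}(-\infty,a]$. In particular, $\phi^{-1}(-\infty,a]$ is a strong deformation retract of $\phi^{-1}(-\infty,b]$. -/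

import Mathlib

open Set Filter Topology

namespace ApproxFlow

/-- The Clarke gradient of `φ` at `x`: the convex hull of all limits of `∇ φ (u n)`, where `u n`
tends to `x` and `φ` is differentiable at every `u n`. -/
noncomputable def clarkeGradient {d : ℕ} (φ : EuclideanSpace ℝ (Fin d) → ℝ)
    (x : EuclideanSpace ℝ (Fin d)) : Set (EuclideanSpace ℝ (Fin d)) :=
  convexHull ℝ {v | ∃ u : ℕ → EuclideanSpace ℝ (Fin d),
    (∀ n, DifferentiableAt ℝ φ (u n)) ∧ Tendsto u atTop (𝓝 x) ∧
      Tendsto (fun n => gradient φ (u n)) atTop (𝓝 v)}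

/-- The distance from the origin to a set, `Δ(A) = inf {‖v‖ : v ∈ A}`. -/
noncomputable def distZero {d : ℕ} (A : Set (EuclideanSpace ℝ (Fin d))) : ℝ :=
  Metric.infDist 0 A

/-- The continuous map `H : [0,1] × X → X` is a strong deformation retraction of `X` onto `A`. -/
structure IsStrongDeformationRetraction {X : Type*} [TopologicalSpace X] (A : Set X)
    (H : C(unitInterval × X, X)) : Prop where
  map_zero : ∀ x, H (0, x) = x
  map_one_mem : ∀ x, H (1, x) ∈ A
  map_fixed : ∀ t, ∀ x ∈ A, H (t, x) = x

end ApproxFlow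

/-! Put `m = μ - ε`. Separation from the origin gives, near each point of `φ⁻¹(a,b]`, a direction of
norm at most 1 along which every existing gradient has component at least `m`. Countably many such
directions, weighted by bumps, sum to a bounded Lipschitz field `X` without zeros on `φ⁻¹(a,b]` and
with `m‖X‖ ≤ ⟨X, ∇φ⟩` wherever `φ` is differentiable. Rademacher's theorem and averaging turn this
gradient inequality into actual descent: along trajectories of `-X`, `φ` drops by at least `m` times
the distance moved.

The trajectories are then indexed by the value of `φ` instead of by time: `C (s, x)` is the point
where `φ` takes the value `φ x - s (b - a)`, stopped at `a`. A trajectory may never attain the level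
`a`, because `X` may vanish in the limit. But by the descent estimate, times at which `φ` converges
give a Cauchy sequence of positions, so the missing point exists by completeness. The same estimate
yields continuity of `C` and the Lipschitz constant `(b - a) / m`. -/

namespace ApproxFlow

open MeasureTheory Metric NNReal

/-! ### Mean value inequality through averaging -/

section MeanValue

variable {E : Type*} [NormedAddCommGroup E] [InnerProductSpace ℝ E] [FiniteDimensional ℝ E]

/-- A mean value inequality for Lipschitz functions: only the points of differentiability matter. -/
theorem LipschitzWith.sub_smul_le_of_le_inner_gradient {ψ : E → ℝ} {K : ℝ≥0}
    (hψ : LipschitzWith K ψ) {y v : E} {ρ c h : ℝ} (hh : 0 ≤ h) (hρ : h * ‖v‖ < ρ)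
    (hc : ∀ z ∈ ball y ρ, DifferentiableAt ℝ ψ z → c ≤ inner ℝ v (gradient ψ z)) :
    ψ (y - h • v) ≤ ψ y - h * c := by
  borelize E
  let ν : Measure E := Measure.addHaar
  by_contra! hlt
  have hcont : Continuous fun z => ψ (z - h • v) - ψ z + h * c := by
    have := hψ.continuous
    fun_prop
  have hev : ∀ᶠ z in 𝓝 y, 0 < ψ (z - h • v) - ψ z + h * c :=
    hcont.continuousAt.eventually_const_lt (by linarith)
  obtain ⟨r₁, hr₁, hball⟩ := Metric.eventually_nhds_iff_ball.1 hev
  obtain ⟨r, hr, hrr₁, hrρ⟩ : ∃ r, 0 < r ∧ r ≤ r₁ ∧ h * ‖v‖ + r < ρ :=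
    ⟨min r₁ ((ρ - h * ‖v‖) / 2), by have : 0 < ρ - h * ‖v‖ := by linarith
                                    positivity, min_le_left _ _, by
      have := min_le_right r₁ ((ρ - h * ‖v‖) / 2)
      linarith⟩
  -- The segment from `y` may lie entirely in the null set where `ψ` is not differentiable, so `ψ`
  -- is averaged over parallel segments starting in a small ball. For each fixed `t`, almost every
  -- translated point is a point of differentiability.
  set κ := ν.restrict (ball y r) with hκ
  have hfin : IsFiniteMeasure κ := ⟨by
    rw [hκ, Measure.restrict_apply_univ]
    exact measure_ball_lt_top⟩
  have hint : ∀ t : ℝ, Integrable (fun z => ψ (z - t • v)) κ := by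
    intro t
    have hc : Continuous fun z => ψ (z - t • v) := by
      have := hψ.continuous
      fun_prop
    exact (hc.continuousOn.integrableOn_compact (isCompact_closedBall y r)).mono_set
      ball_subset_closedBall
  have hderiv : ∀ t : ℝ, Integrable (fun z => - fderiv ℝ ψ (z - t • v) v) κ ∧
      HasDerivAt (fun t => ∫ z, ψ (z - t • v) ∂κ) (∫ z, - fderiv ℝ ψ (z - t • v) v ∂κ) t := by
    intro t
    refine hasDerivAt_integral_of_dominated_loc_of_lip (s := univ)
      (bound := fun _ => K * ‖v‖) univ_mem
      (Eventually.of_forall fun s => (hint s).aestronglyMeasurable) (hint t) ?_ ?_ ?_ ?_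
    · have : Measurable fun z => fderiv ℝ ψ z v := measurable_fderiv_apply_const ℝ ψ v
      exact ((this.comp (measurable_id.sub_const _)).neg).aestronglyMeasurable
    · refine Eventually.of_forall fun z => ?_
      rw [lipschitzOnWith_univ]
      refine LipschitzWith.of_dist_le_mul fun s s' => ?_
      refine (hψ.dist_le_mul _ _).trans ?_
      have : (↑(Real.nnabs (K * ‖v‖)) : ℝ) = K * ‖v‖ := by
        simp
      rw [this, dist_eq_norm, Real.dist_eq]
      have : z - s • v - (z - s' • v) = (s' - s) • v := by module
      rw [this, norm_smul, Real.norm_eq_abs, abs_sub_comm]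
      exact le_of_eq (by ring)
    · exact integrable_const _
    · have hae : ∀ᵐ z ∂ν, DifferentiableAt ℝ ψ (z - t • v) := by
        have := (measurePreserving_sub_right ν (t • v)).quasiMeasurePreserving.ae
          (hψ.ae_differentiableAt (μ := ν))
        exact this
      refine ae_restrict_of_ae (hae.mono fun z hz => ?_)
      have h1 : HasDerivAt (fun s : ℝ => z - s • v) (-v) t := by
        simpa using ((hasDerivAt_id t).smul_const v).const_sub z
      have h2 := hz.hasFDerivAt.comp_hasDerivAt t h1
      simpa [Function.comp_def] using h2
  have hbound : ∀ t ∈ Icc 0 h, (∫ z, - fderiv ℝ ψ (z - t • v) v ∂κ) ≤ - c * κ.real univ := by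
    intro t ht
    have hae : ∀ᵐ z ∂ν, DifferentiableAt ℝ ψ (z - t • v) := by
      have := (measurePreserving_sub_right ν (t • v)).quasiMeasurePreserving.ae
        (hψ.ae_differentiableAt (μ := ν))
      exact this
    have : (∫ z, - fderiv ℝ ψ (z - t • v) v ∂κ) ≤ ∫ _, -c ∂κ := by
      refine integral_mono_ae (hderiv t).1 (integrable_const _) ?_
      filter_upwards [ae_restrict_of_ae hae, ae_restrict_mem measurableSet_ball] with z hz hzb
      have hmem : z - t • v ∈ ball y ρ := by
        rw [mem_ball, dist_eq_norm] at hzb ⊢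
        have h1 : ‖z - t • v - y‖ ≤ ‖z - y‖ + ‖t • v‖ := by
          have : z - t • v - y = (z - y) - t • v := by abel
          rw [this]
          exact norm_sub_le _ _
        rw [norm_smul, Real.norm_eq_abs, abs_of_nonneg ht.1] at h1
        nlinarith [ht.2, norm_nonneg v]
      have h3 := hc _ hmem hz
      have h4 : inner ℝ v (gradient ψ (z - t • v)) = fderiv ℝ ψ (z - t • v) v := by
        rw [real_inner_comm, gradient, InnerProductSpace.toDual_symm_apply]
      linarith
    refine this.trans (le_of_eq ?_)
    simp [mul_comm]
  have hmono : (∫ z, ψ (z - h • v) ∂κ) ≤ (∫ z, ψ (z - (0 : ℝ) • v) ∂κ) + -c * κ.real univ * h := by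
    have := image_le_of_deriv_right_le_deriv_boundary (a := 0) (b := h)
      (f := fun t => ∫ z, ψ (z - t • v) ∂κ)
      (f' := fun t => ∫ z, - fderiv ℝ ψ (z - t • v) v ∂κ)
      (B := fun t => (∫ z, ψ (z - (0 : ℝ) • v) ∂κ) + -c * κ.real univ * t)
      (B' := fun _ => -c * κ.real univ)
      (fun t _ => (hderiv t).2.continuousAt.continuousWithinAt)
      (fun t _ => (hderiv t).2.hasDerivWithinAt) (by simp) (by fun_prop)
      (fun t _ => by
        simpa only [mul_one, id] using (((hasDerivAt_id t).const_mul (-c * κ.real univ)).const_add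
          (∫ z, ψ (z - (0 : ℝ) • v) ∂κ)).hasDerivWithinAt)
      (fun t ht => hbound t (Ico_subset_Icc_self ht))
    exact this (right_mem_Icc.2 hh)
  have hpos : 0 < ∫ z, (ψ (z - h • v) - ψ (z - (0 : ℝ) • v) + h * c) ∂κ := by
    have hi : Integrable (fun z => ψ (z - h • v) - ψ (z - (0 : ℝ) • v) + h * c) κ :=
      ((hint h).sub (hint 0)).add (integrable_const _)
    refine (setIntegral_pos_iff_support_of_nonneg_ae ?_ hi).2 ?_
    · filter_upwards [ae_restrict_mem measurableSet_ball] with z hz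
      have := hball z (ball_subset_ball hrr₁ hz)
      simpa using this.le
    · refine (measure_ball_pos ν y hr).trans_le (measure_mono fun z hz => ⟨?_, hz⟩)
      have := hball z (ball_subset_ball hrr₁ hz)
      simpa using this.ne'
  have hsub : Integrable (fun z => ψ (z - h • v) - ψ (z - (0 : ℝ) • v)) κ := (hint h).sub (hint 0)
  rw [integral_add hsub (integrable_const _),
    integral_sub (hint h) (hint 0), integral_const] at hpos
  simp only [smul_eq_mul] at hpos
  linarith

/-- A global Lipschitz extension agrees with `φ` on the open ball, hence has the same gradients
there. -/
theorem LipschitzOnWith.sub_smul_le_of_le_inner_gradient {φ : E → ℝ} {K : ℝ≥0} {y v : E}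
    {ρ c h : ℝ} (hφ : LipschitzOnWith K φ (ball y ρ)) (hh : 0 ≤ h) (hρ : h * ‖v‖ < ρ)
    (hc : ∀ z ∈ ball y ρ, DifferentiableAt ℝ φ z → c ≤ inner ℝ v (gradient φ z)) :
    φ (y - h • v) ≤ φ y - h * c := by
  obtain ⟨ψ, hψ, heq⟩ := hφ.extend_real
  have hpos : 0 < ρ := (by positivity : 0 ≤ h * ‖v‖).trans_lt hρ
  have hmem : y - h • v ∈ ball y ρ := by
    simpa [mem_ball, dist_eq_norm, norm_smul, abs_of_nonneg hh] using hρ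
  rw [heq hmem, heq (mem_ball_self hpos)]
  refine LipschitzWith.sub_smul_le_of_le_inner_gradient hψ hh hρ fun z hz hd => ?_
  have hev : φ =ᶠ[𝓝 z] ψ := heq.eventuallyEq_of_mem (isOpen_ball.mem_nhds hz)
  have := hc z hz (hev.differentiableAt_iff.2 hd)
  rwa [gradient, hev.fderiv_eq] at this

end MeanValue

/-! ### Forward trajectories of bounded Lipschitz fields -/

section Flow

variable {E : Type*} [NormedAddCommGroup E] [NormedSpace ℝ E]

theorem dist_le_of_hasDerivWithinAt_Icc {v : E → E} {K : ℝ≥0} (hv : LipschitzWith K v)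
    {f g : ℝ → E} {T : ℝ}
    (hf : ∀ t ∈ Icc 0 T, HasDerivWithinAt f (v (f t)) (Icc 0 T) t)
    (hg : ∀ t ∈ Icc 0 T, HasDerivWithinAt g (v (g t)) (Icc 0 T) t)
    {t : ℝ} (ht : t ∈ Icc 0 T) :
    dist (f t) (g t) ≤ dist (f 0) (g 0) * Real.exp (K * t) := by
  have key : ∀ {f : ℝ → E}, (∀ t ∈ Icc 0 T, HasDerivWithinAt f (v (f t)) (Icc 0 T) t) →
      ∀ t ∈ Ico 0 T, HasDerivWithinAt f (v (f t)) (Ici t) t := fun hf t ht =>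
    ((hf t (Ico_subset_Icc_self ht)).mono (Icc_subset_Icc_left ht.1)).mono_of_mem_nhdsWithin
      (Icc_mem_nhdsGE ht.2)
  simpa using dist_le_of_trajectories_ODE (fun _ => hv)
    (fun s hs => (hf s hs).continuousWithinAt) (key hf)
    (fun s hs => (hg s hs).continuousWithinAt) (key hg) le_rfl t ht

/-- A bounded Lipschitz vector field has forward trajectories defined for all times. -/
theorem exists_forward_trajectory [CompleteSpace E] {v : E → E} {K C : ℝ≥0}
    (hv : LipschitzWith K v) (hC : ∀ x, ‖v x‖ ≤ C) (x : E) :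
    ∃ γ : ℝ → E, γ 0 = x ∧ ∀ t, 0 ≤ t → HasDerivWithinAt γ (v (γ t)) (Ici 0) t := by
  have hloc : ∀ n : ℕ, ∃ γ : ℝ → E, γ 0 = x ∧
      ∀ t ∈ Icc (0 : ℝ) n, HasDerivWithinAt γ (v (γ t)) (Icc (0 : ℝ) n) t := by
    intro n
    have h0 : (0 : ℝ) ∈ Icc (0 : ℝ) n := ⟨le_rfl, n.cast_nonneg⟩
    -- A solution of speed at most `C` stays within `C * n` of `x`, so this radius allows the whole
    -- interval at once.
    have hPL : IsPicardLindelof (fun _ => v) (⟨0, h0⟩ : Icc (0 : ℝ) n) x (C * n) 0 C K :=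
      { lipschitzOnWith := fun _ _ => hv.lipschitzOnWith
        continuousOn := fun _ _ => continuousOn_const
        norm_le := fun _ _ _ _ => hC _
        mul_max_le := by simp }
    exact hPL.exists_eq_forall_mem_Icc_hasDerivWithinAt₀
  choose γ hγ0 hγ using hloc
  have hagree : ∀ m n : ℕ, m ≤ n → ∀ t ∈ Icc (0 : ℝ) m, γ m t = γ n t := by
    intro m n hmn t ht
    have hsub : Icc (0 : ℝ) m ⊆ Icc (0 : ℝ) n := Icc_subset_Icc_right (by exact_mod_cast hmn)
    have := dist_le_of_hasDerivWithinAt_Icc hv (hγ m)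
      (fun t ht => (hγ n t (hsub ht)).mono hsub) ht
    rw [hγ0, hγ0, dist_self, zero_mul] at this
    exact dist_le_zero.1 this
  have hext : ∀ n : ℕ, ∀ t ∈ Icc (0 : ℝ) n, γ ⌈t⌉₊ t = γ n t := fun n t ht =>
    hagree _ _ (Nat.ceil_le.2 ht.2) t ⟨ht.1, Nat.le_ceil t⟩
  refine ⟨fun t => γ ⌈t⌉₊ t, by simp [hγ0], fun t ht => ?_⟩
  -- The extra 1 keeps `t` away from the right endpoint, where the derivative would only be
  -- one-sided.
  have htn : t < (⌈t⌉₊ + 1 : ℕ) := by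
    push_cast
    linarith [Nat.le_ceil t]
  have hmem : t ∈ Icc (0 : ℝ) (⌈t⌉₊ + 1 : ℕ) := ⟨ht, htn.le⟩
  have h1 : HasDerivWithinAt (fun t => γ ⌈t⌉₊ t) (v (γ (⌈t⌉₊ + 1) t))
      (Icc (0 : ℝ) (⌈t⌉₊ + 1 : ℕ)) t :=
    (hγ (⌈t⌉₊ + 1) t hmem).congr (hext (⌈t⌉₊ + 1)) (hext _ _ hmem)
  rw [← hext _ _ hmem] at h1
  refine h1.mono_of_mem_nhdsWithin ?_
  rw [← Ici_inter_Iic]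
  exact inter_mem self_mem_nhdsWithin (mem_nhdsWithin_of_mem_nhds (Iic_mem_nhds htn))

theorem dist_forward_trajectory_le {v : E → E} {K : ℝ≥0} (hv : LipschitzWith K v)
    {f g : ℝ → E}
    (hf : ∀ t, 0 ≤ t → HasDerivWithinAt f (v (f t)) (Ici 0) t)
    (hg : ∀ t, 0 ≤ t → HasDerivWithinAt g (v (g t)) (Ici 0) t)
    {t : ℝ} (ht : 0 ≤ t) :
    dist (f t) (g t) ≤ dist (f 0) (g 0) * Real.exp (K * t) :=
  dist_le_of_hasDerivWithinAt_Icc (T := t) hv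
    (fun s hs => (hf s hs.1).mono Icc_subset_Ici_self)
    (fun s hs => (hg s hs.1).mono Icc_subset_Ici_self) ⟨ht, le_rfl⟩

/-- The limit of a forward trajectory is a zero of the vector field. -/
theorem eq_zero_of_tendsto_trajectory {v : E → E} (hv : Continuous v) {γ : ℝ → E}
    (hγ : ∀ t, 0 ≤ t → HasDerivWithinAt γ (v (γ t)) (Ici 0) t) {y : E}
    (hy : Tendsto γ atTop (𝓝 y)) : v y = 0 := by
  have h1 : Tendsto (fun t => γ (t + 1) - γ t) atTop (𝓝 0) := by
    simpa using (hy.comp (tendsto_atTop_add_const_right _ 1 tendsto_id)).sub hy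
  have h2 : Tendsto (fun t => γ (t + 1) - γ t) atTop (𝓝 (v y)) := by
    rw [Metric.tendsto_atTop]
    intro δ hδ
    obtain ⟨N, hN⟩ := Metric.tendsto_atTop.1 ((hv.tendsto y).comp hy) (δ / 2) (by positivity)
    refine ⟨max N 0, fun t ht => ?_⟩
    have ht0 : 0 ≤ t := (le_max_right _ _).trans ht
    have htN : N ≤ t := (le_max_left _ _).trans ht
    have hd : ∀ s ∈ Icc t (t + 1), HasDerivWithinAt (fun s => γ s - (s - t) • v y)
        (v (γ s) - v y) (Icc t (t + 1)) s := fun s hs => by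
      have h3 : HasDerivWithinAt (fun s : ℝ => (s - t) • v y) ((1 : ℝ) • v y)
        (Icc t (t + 1)) s := (((hasDerivAt_id s).sub_const t).smul_const (v y)).hasDerivWithinAt
      rw [one_smul] at h3
      exact ((hγ s (ht0.trans hs.1)).mono
        (Icc_subset_Ici_self.trans (Ici_subset_Ici.2 ht0))).sub h3
    have := norm_image_sub_le_of_norm_deriv_le_segment' hd (C := δ / 2)
      (fun s hs => by
        have := hN s (htN.trans hs.1)
        rw [dist_eq_norm] at this
        exact this.le) (t + 1) (right_mem_Icc.2 (by linarith))
    rw [dist_eq_norm]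
    have h4 : γ (t + 1) - γ t - v y =
      γ (t + 1) - (t + 1 - t) • v y - (γ t - (t - t) • v y) := by simp; abel
    rw [h4]
    linarith
  exact tendsto_nhds_unique h2 h1

end Flow

/-! ### Local gradient bounds and the Clarke gradient -/

theorem _root_.LocallyLipschitz.exists_ball {E : Type*} [PseudoMetricSpace E] {φ : E → ℝ}
    (hφ : LocallyLipschitz φ) (x : E) :
    ∃ K : ℝ≥0, ∃ r > 0, LipschitzOnWith K φ (ball x r) := by
  obtain ⟨K, t, ht, hK⟩ := hφ x
  obtain ⟨r, hr, hrt⟩ := Metric.mem_nhds_iff.1 ht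
  exact ⟨K, r, hr, hK.mono hrt⟩

section Gradient

variable {E : Type*} [NormedAddCommGroup E] [InnerProductSpace ℝ E] [CompleteSpace E]

theorem norm_gradient_le_of_lipschitzOn {φ : E → ℝ} {s : Set E} {K : ℝ≥0} {z : E} (hs : s ∈ 𝓝 z)
    (hφ : LipschitzOnWith K φ s) : ‖gradient φ z‖ ≤ K := by
  rw [gradient, LinearIsometryEquiv.norm_map]
  exact norm_fderiv_le_of_lipschitzOn ℝ hs hφ

end Gradient

theorem _root_.LocallyLipschitz.frequently_differentiableAt {E : Type*} [NormedAddCommGroup E]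
    [InnerProductSpace ℝ E] [FiniteDimensional ℝ E] {φ : E → ℝ} (hφ : LocallyLipschitz φ) (x : E) :
    ∃ᶠ z in 𝓝 x, DifferentiableAt ℝ φ z := by
  borelize E
  obtain ⟨K, r, hr, hK⟩ := hφ.exists_ball x
  obtain ⟨ψ, hψ, heq⟩ := hK.extend_real
  have hd : Dense {z | DifferentiableAt ℝ ψ z} :=
    Measure.dense_of_ae (hψ.ae_differentiableAt (μ := Measure.addHaar))
  have hf : ∃ᶠ z in 𝓝 x, DifferentiableAt ℝ ψ z := mem_closure_iff_frequently.1 (hd x)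
  refine (hf.and_eventually (ball_mem_nhds x hr)).mono fun z hz => ?_
  exact (heq.eventuallyEq_of_mem (isOpen_ball.mem_nhds hz.2)).differentiableAt_iff.2 hz.1

/-- If the Clarke gradient at `x` stays away from the origin, then all gradients near `x` have
a large component in a common direction. -/
theorem exists_le_inner_gradient {d : ℕ} {φ : EuclideanSpace ℝ (Fin d) → ℝ}
    (hφ : LocallyLipschitz φ) {x : EuclideanSpace ℝ (Fin d)} {μ m : ℝ} (hμ : 0 < μ) (hm : m < μ)
    (h : μ ≤ distZero (clarkeGradient φ x)) :
    ∃ w : EuclideanSpace ℝ (Fin d), ‖w‖ ≤ 1 ∧ ∃ r > 0, ∀ z ∈ ball x r,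
      DifferentiableAt ℝ φ z → m ≤ inner ℝ w (gradient φ z) := by
  set A := clarkeGradient φ x with hA
  -- `infDist` to the empty set is 0 by convention, which contradicts `0 < μ`.
  have hne : A.Nonempty := by
    by_contra hne
    rw [not_nonempty_iff_eq_empty] at hne
    rw [distZero, hne, infDist_empty] at h
    linarith
  have hconv : Convex ℝ (closure A) := (convex_convexHull ℝ _).closure
  obtain ⟨p, hp, hpmin⟩ := exists_norm_eq_iInf_of_complete_convex hne.closure
    isClosed_closure.isComplete hconv 0
  rw [norm_eq_iInf_iff_real_inner_le_zero hconv hp] at hpmin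
  have hpμ : μ ≤ ‖p‖ := by
    have := infDist_le_dist_of_mem (x := 0) hp
    rw [infDist_closure, dist_zero_left] at this
    exact h.trans this
  have hp0 : 0 < ‖p‖ := hμ.trans_le hpμ
  -- The point `p` of least norm in the closure separates: `‖p‖ ^ 2 ≤ ⟨p, v⟩` for all `v ∈ A`.
  have hpos : ∀ v ∈ A, μ ≤ inner ℝ (‖p‖⁻¹ • p) v := by
    intro v hv
    have h1 := hpmin v (subset_closure hv)
    rw [zero_sub, inner_neg_left, inner_sub_right, real_inner_self_eq_norm_sq] at h1
    rw [real_inner_smul_left, inv_mul_eq_div, le_div_iff₀ hp0]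
    nlinarith
  refine ⟨‖p‖⁻¹ • p, by rw [norm_smul, norm_inv, norm_norm, inv_mul_cancel₀ hp0.ne'], ?_⟩
  -- Otherwise bad gradients occur at points tending to `x`; being bounded, they subconverge to an
  -- element of `A` that violates `hpos`.
  by_contra! hcon
  choose u hu hdiff hlt using fun n : ℕ => hcon (1 / ((n : ℝ) + 1)) Nat.one_div_pos_of_nat
  have hux : Tendsto u atTop (𝓝 x) := by
    rw [tendsto_iff_dist_tendsto_zero]
    exact squeeze_zero (fun _ => dist_nonneg) (fun n => (mem_ball.1 (hu n)).le)
      tendsto_one_div_add_atTop_nhds_zero_nat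
  obtain ⟨K, r, hr, hK⟩ := hφ.exists_ball x
  have hbdd : ∀ᶠ n in atTop, gradient φ (u n) ∈ closedBall 0 (K : ℝ) := by
    filter_upwards [hux.eventually (ball_mem_nhds x hr)] with n hn
    rw [mem_closedBall_zero_iff]
    exact norm_gradient_le_of_lipschitzOn (isOpen_ball.mem_nhds hn) hK
  obtain ⟨v, -, θ, hθ, hv⟩ := (isCompact_closedBall _ _).tendsto_subseq' hbdd.frequently
  have hvA : v ∈ A := subset_convexHull ℝ _
    ⟨u ∘ θ, fun n => hdiff _, hux.comp hθ.tendsto_atTop, hv⟩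
  have hle : inner ℝ (‖p‖⁻¹ • p) v ≤ m :=
    le_of_tendsto (tendsto_const_nhds.inner hv) (Eventually.of_forall fun n => (hlt _).le)
  linarith [hpos v hvA]

/-! ### Pseudo-gradient field -/

section Field

variable {ι E F : Type*} [NormedAddCommGroup E]
  [NormedAddCommGroup F] [NormedSpace ℝ F]

/-- A nonnegative `1`-Lipschitz function bounded by `1` with support `ball x r`. -/
noncomputable def bump (x : E) (r : ℝ) (z : E) : ℝ := min 1 (max 0 (r - dist z x))

theorem bump_nonneg (x : E) (r : ℝ) (z : E) : 0 ≤ bump x r z :=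
  le_min zero_le_one (le_max_left _ _)

theorem bump_le_one (x : E) (r : ℝ) (z : E) : bump x r z ≤ 1 := min_le_left _ _

theorem bump_pos {x : E} {r : ℝ} {z : E} (hz : z ∈ ball x r) : 0 < bump x r z :=
  lt_min one_pos (lt_max_of_lt_right (sub_pos.2 hz))

theorem bump_eq_zero {x : E} {r : ℝ} {z : E} (hz : z ∉ ball x r) : bump x r z = 0 := by
  rw [mem_ball, not_lt] at hz
  rw [bump, max_eq_left (by linarith), min_eq_right zero_le_one]

theorem lipschitzWith_bump (x : E) (r : ℝ) : LipschitzWith 1 (bump x r) := by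
  have h : LipschitzWith 1 fun z : E => r - dist z x := by
    refine LipschitzWith.of_dist_le_mul fun z z' => ?_
    rw [Real.dist_eq, NNReal.coe_one, one_mul, sub_sub_sub_cancel_left, abs_sub_comm]
    exact abs_dist_sub_le _ _ _
  exact (h.const_max 0).const_min 1

variable {c : ι → ℝ≥0} {C : ℝ≥0} {x : ι → E} {r : ι → ℝ} {w : ι → F}

theorem norm_bump_smul_le (hw : ∀ i, ‖w i‖ ≤ 1) (z : E) (i : ι) :
    ‖((c i : ℝ) * bump (x i) (r i) z) • w i‖ ≤ c i * bump (x i) (r i) z := by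
  rw [norm_smul, Real.norm_of_nonneg (mul_nonneg (c i).coe_nonneg (bump_nonneg _ _ _))]
  exact mul_le_of_le_one_right (mul_nonneg (c i).coe_nonneg (bump_nonneg _ _ _)) (hw i)

theorem summable_mul_bump (hc : HasSum c C) (z : E) :
    Summable fun i => (c i : ℝ) * bump (x i) (r i) z :=
  (NNReal.hasSum_coe.2 hc).summable.of_nonneg_of_le
    (fun i => mul_nonneg (c i).coe_nonneg (bump_nonneg _ _ _))
    (fun i => mul_le_of_le_one_right (c i).coe_nonneg (bump_le_one _ _ _))

theorem summable_bump_smul [CompleteSpace F] (hc : HasSum c C) (hw : ∀ i, ‖w i‖ ≤ 1) (z : E) :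
    Summable fun i => ((c i : ℝ) * bump (x i) (r i) z) • w i :=
  (summable_mul_bump hc z).of_norm_bounded (norm_bump_smul_le hw z)

/-- The `i`-th term is `c i`-Lipschitz, so summable weights replace local finiteness of the cover.
-/
theorem lipschitzWith_tsum_bump_smul [CompleteSpace F] (hc : HasSum c C) (hw : ∀ i, ‖w i‖ ≤ 1) :
    LipschitzWith C fun z : E => ∑' i, ((c i : ℝ) * bump (x i) (r i) z) • w i := by
  refine LipschitzWith.of_dist_le_mul fun z z' => ?_
  rw [dist_eq_norm, ← (summable_bump_smul hc hw z).tsum_sub (summable_bump_smul hc hw z')]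
  refine tsum_of_norm_bounded ((NNReal.hasSum_coe.2 hc).mul_right (dist z z')) fun i => ?_
  rw [← sub_smul, ← mul_sub, norm_smul, norm_mul, Real.norm_of_nonneg (c i).coe_nonneg, mul_assoc]
  refine mul_le_mul_of_nonneg_left ?_ (c i).coe_nonneg
  have h1 := (lipschitzWith_bump (x i) (r i)).dist_le_mul z z'
  rw [Real.dist_eq, NNReal.coe_one, one_mul] at h1
  exact (mul_le_of_le_one_right (norm_nonneg _) (hw i)).trans h1

end Field

/-- If every point of `S` has a ball on which the gradients of `φ` have a large component in a
common direction, these directions combine to a bounded Lipschitz pseudo-gradient field that has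
no zero in `S`. -/
theorem exists_lipschitz_pseudoGradient {E : Type*} [NormedAddCommGroup E] [InnerProductSpace ℝ E]
    [FiniteDimensional ℝ E] {φ : E → ℝ} (hφ : LocallyLipschitz φ) {S : Set E} {m : ℝ}
    (hm : 0 < m)
    (h : ∀ x ∈ S, ∃ w : E, ‖w‖ ≤ 1 ∧ ∃ r > 0, ∀ z ∈ ball x r,
      DifferentiableAt ℝ φ z → m ≤ inner ℝ w (gradient φ z)) :
    ∃ X : E → E, LipschitzWith 1 X ∧ (∀ z, ‖X z‖ ≤ 1) ∧ (∀ z ∈ S, X z ≠ 0) ∧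
      ∀ z, DifferentiableAt ℝ φ z → m * ‖X z‖ ≤ inner ℝ (X z) (gradient φ z) := by
  have : CompleteSpace E := FiniteDimensional.complete ℝ E
  have : SecondCountableTopology E := by
    have := FiniteDimensional.proper ℝ E
    infer_instance
  choose! w hw r hr hwr using h
  obtain ⟨t, htS, htc, htcov⟩ := TopologicalSpace.countable_cover_nhdsWithin
    (f := fun x => ball x (r x)) (s := S)
    (fun x hx => mem_nhdsWithin_of_mem_nhds (ball_mem_nhds x (hr x hx)))
  have : Countable t := htc.to_subtype
  obtain ⟨c, hc0, C, hcC, hC⟩ := NNReal.exists_pos_sum_of_countable (ε := 1) one_ne_zero t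
  have hw' : ∀ i : t, ‖w i‖ ≤ 1 := fun i => hw _ (htS i.2)
  set coeff : t → E → ℝ := fun i z => (c i : ℝ) * bump (i : E) (r i) z with hcoeff
  have hcoeff0 : ∀ i z, 0 ≤ coeff i z := fun i z => mul_nonneg (c i).coe_nonneg (bump_nonneg _ _ _)
  set X : E → E := fun z => ∑' i : t, coeff i z • w i with hX
  -- Total weight: it dominates `‖X‖` and is positive on `S`.
  set σ : E → ℝ := fun z => ∑' i : t, coeff i z • (1 : ℝ) with hσ
  have hXsum : ∀ z, Summable fun i : t => coeff i z • w i := fun z => summable_bump_smul hcC hw' z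
  have hσsum : ∀ z, Summable fun i : t => coeff i z • (1 : ℝ) := fun z =>
    summable_bump_smul hcC (fun _ => by simp) z
  have hXL : LipschitzWith C X := lipschitzWith_tsum_bump_smul hcC hw'
  have hσL : LipschitzWith C σ := lipschitzWith_tsum_bump_smul hcC (fun _ => by simp)
  have hXσ : ∀ z, ‖X z‖ ≤ σ z := fun z =>
    tsum_of_norm_bounded (hσsum z).hasSum fun i => by
      simpa using norm_bump_smul_le (c := c) (x := fun i : t => (i : E))
        (r := fun i : t => r i) hw' z i
  have hσ1 : ∀ z, σ z ≤ 1 := fun z => by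
    refine (hasSum_le (fun i => ?_) (hσsum z).hasSum (NNReal.hasSum_coe.2 hcC)).trans
      (by exact_mod_cast hC.le)
    simpa using mul_le_of_le_one_right (c i).coe_nonneg (bump_le_one (i : E) (r i) z)
  have hpos : ∀ z ∈ S, 0 < σ z := by
    intro z hz
    obtain ⟨i, hi, hzi⟩ := mem_iUnion₂.1 (htcov hz)
    refine (hσsum z).tsum_pos (fun j => by simpa using hcoeff0 j z) ⟨i, hi⟩ ?_
    simpa using mul_pos (NNReal.coe_pos.2 (hc0 ⟨i, hi⟩)) (bump_pos hzi)
  have hinner : ∀ z, DifferentiableAt ℝ φ z → m * σ z ≤ inner ℝ (X z) (gradient φ z) := by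
    intro z hz
    have h1 : HasSum (fun i : t => inner ℝ (gradient φ z) (coeff i z • w i))
        (inner ℝ (gradient φ z) (X z)) :=
      (innerSL ℝ (gradient φ z)).hasSum (hXsum z).hasSum
    rw [real_inner_comm]
    refine hasSum_le (fun i => ?_) ((hσsum z).hasSum.mul_left m) h1
    by_cases hzi : z ∈ ball (i : E) (r i)
    · rw [real_inner_smul_right, real_inner_comm, smul_eq_mul, mul_one, mul_comm]
      exact mul_le_mul_of_nonneg_left (hwr _ (htS i.2) z hzi hz) (hcoeff0 i z)
    · simp [hcoeff, bump_eq_zero hzi]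
  refine ⟨X, hXL.weaken hC.le, fun z => (hXσ z).trans (hσ1 z), fun y hy => ?_,
    fun z hz => (mul_le_mul_of_nonneg_left (hXσ z) hm.le).trans (hinner z hz)⟩
  obtain ⟨K, ρ, hρ, hK⟩ := hφ.exists_ball y
  -- `φ` need not be differentiable at `y`, so the bound on `σ` is obtained at nearby points of
  -- differentiability and passes to `y` by closedness. A zero of `X` at `y` would then force `σ y ≤
  -- 0`.
  have hclosed : IsClosed {z | m * σ z ≤ ‖X z‖ * K} :=
    isClosed_le (continuous_const.mul hσL.continuous) (hXL.continuous.norm.mul continuous_const)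
  have hfreq : ∃ᶠ z in 𝓝 y, z ∈ {z | m * σ z ≤ ‖X z‖ * K} := by
    refine ((hφ.frequently_differentiableAt y).and_eventually (ball_mem_nhds y hρ)).mono
      fun z hz => (hinner z hz.1).trans ((real_inner_le_norm _ _).trans ?_)
    exact mul_le_mul_of_nonneg_left
      (norm_gradient_le_of_lipschitzOn (isOpen_ball.mem_nhds hz.2) hK) (norm_nonneg _)
  have hle := hclosed.mem_of_frequently_of_tendsto hfreq tendsto_id
  intro h0
  simp only [mem_ofPred_eq, h0, norm_zero, zero_mul] at hle
  exact absurd (mul_pos hm (hpos y hy)) (not_lt.2 hle)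

/-! ### Descent along trajectories -/

section Descent

variable {E : Type*} [NormedAddCommGroup E] [InnerProductSpace ℝ E] [FiniteDimensional ℝ E]
  {φ : E → ℝ} {X : E → E} {m : ℝ} {γ : ℝ → E}

/-- Infinitesimal form of `mul_dist_le_sub_of_trajectory`. -/
theorem eventually_slope_lt_of_trajectory (hφ : LocallyLipschitz φ) {L : ℝ≥0}
    (hX : LipschitzWith L X) (hm : 0 ≤ m)
    (hgrad : ∀ z, DifferentiableAt ℝ φ z → m * ‖X z‖ ≤ inner ℝ (X z) (gradient φ z))
    {t : ℝ} (hγ : HasDerivWithinAt γ (-X (γ t)) (Ici t) t) (y : E) {r : ℝ} (hr : 0 < r) :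
    ∀ᶠ z in 𝓝[>] t, slope (fun z => φ (γ z) + m * ‖γ z - y‖) t z < r := by
  obtain ⟨K, ρ₀, hρ₀, hK⟩ := hφ.exists_ball (γ t)
  -- The three errors: variation of `X` near `γ t`, and the first-order remainder of `γ` as seen by
  -- `φ` and by the distance term.
  obtain ⟨η, hη, hηr⟩ : ∃ η : ℝ, 0 < η ∧ η + K * η + m * η < r := by
    have hpos : 0 < (K : ℝ) + m + 2 := by positivity
    refine ⟨r / (K + m + 2), by positivity, ?_⟩
    have : r / (K + m + 2) + K * (r / (K + m + 2)) + m * (r / (K + m + 2)) =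
      r - r / (K + m + 2) := by field_simp; ring
    rw [this]
    linarith [div_pos hr hpos]
  obtain ⟨ρ, hρ, hρρ₀, hρη⟩ : ∃ ρ, 0 < ρ ∧ ρ ≤ ρ₀ ∧ (m + K) * (L * ρ) ≤ η := by
    have hpos : 0 < (m + K) * L + 1 := by positivity
    refine ⟨min ρ₀ (η / ((m + K) * L + 1)), by positivity, min_le_left _ _, ?_⟩
    calc (m + K) * (L * min ρ₀ (η / ((m + K) * L + 1)))
        ≤ (m + K) * (L * (η / ((m + K) * L + 1))) := by
          gcongr
          exact min_le_right _ _
      _ = η * ((m + K) * L) / ((m + K) * L + 1) := by ring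
      _ ≤ η := by
          rw [div_le_iff₀ hpos]
          nlinarith
  set v := X (γ t) with hv
  have hc : ∀ z ∈ ball (γ t) ρ, DifferentiableAt ℝ φ z →
      m * ‖v‖ - η ≤ inner ℝ v (gradient φ z) := by
    intro z hz hd
    have hgK : ‖gradient φ z‖ ≤ K :=
      norm_gradient_le_of_lipschitzOn (isOpen_ball.mem_nhds (ball_subset_ball hρρ₀ hz)) hK
    have hXz : ‖v - X z‖ ≤ L * ρ := by
      rw [← dist_eq_norm]
      refine (hX.dist_le_mul _ _).trans ?_
      rw [dist_comm]
      exact mul_le_mul_of_nonneg_left (mem_ball.1 hz).le L.coe_nonneg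
    have h1 : -(L * ρ * K) ≤ inner ℝ (v - X z) (gradient φ z) := by
      have := abs_real_inner_le_norm (v - X z) (gradient φ z)
      have h2 : ‖v - X z‖ * ‖gradient φ z‖ ≤ L * ρ * K := by gcongr
      linarith [neg_abs_le (inner ℝ (v - X z) (gradient φ z))]
    have h2 : ‖v‖ ≤ ‖X z‖ + L * ρ := by
      have := norm_sub_norm_le v (X z)
      linarith
    have h3 := hgrad z hd
    rw [inner_sub_left] at h1
    nlinarith
  have hlo : ∀ᶠ z in 𝓝[>] t, ‖γ z - γ t - (z - t) • -v‖ ≤ η * ‖z - t‖ :=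
    (hγ.mono Ioi_subset_Ici_self).hasFDerivWithinAt.isLittleO.def hη
  have hball : ∀ᶠ z in 𝓝[>] t, γ z ∈ ball (γ t) ρ :=
    (hγ.continuousWithinAt.mono Ioi_subset_Ici_self).eventually (ball_mem_nhds _ hρ)
  have hsmall : ∀ᶠ z in 𝓝[>] t, (z - t) * ‖v‖ < ρ := by
    have : ContinuousAt (fun z : ℝ => (z - t) * ‖v‖) t := by fun_prop
    exact nhdsWithin_le_nhds (this.eventually_lt_const (by simpa using hρ))
  filter_upwards [hlo, hball, hsmall, self_mem_nhdsWithin] with z hz hzb hzs hzt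
  have hh : 0 < z - t := sub_pos.2 hzt
  set h := z - t with hh'
  rw [Real.norm_of_nonneg hh.le] at hz
  have hstep := LipschitzOnWith.sub_smul_le_of_le_inner_gradient
    (hK.mono (ball_subset_ball hρρ₀)) hh.le hzs hc
  have hmem : γ t - h • v ∈ ball (γ t) ρ := by
    simpa [mem_ball, dist_eq_norm, norm_smul, abs_of_nonneg hh.le] using hzs
  have hdiff : γ z - (γ t - h • v) = γ z - γ t - h • -v := by
    rw [smul_neg]; abel
  have h1 : φ (γ z) ≤ φ (γ t - h • v) + K * (η * h) := by
    have := hK.dist_le_mul _ (ball_subset_ball hρρ₀ hzb) _ (ball_subset_ball hρρ₀ hmem)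
    rw [dist_eq_norm (γ z), hdiff, Real.dist_eq] at this
    have h2 : (K : ℝ) * ‖γ z - γ t - h • -v‖ ≤ K * (η * h) := by gcongr
    linarith [le_abs_self (φ (γ z) - φ (γ t - h • v))]
  have h2 : ‖γ z - γ t‖ ≤ h * ‖v‖ + η * h := by
    have := norm_add_le (γ z - γ t - h • -v) (h • -v)
    rw [sub_add_cancel, norm_smul, norm_neg, Real.norm_of_nonneg hh.le] at this
    linarith
  have h3 : ‖γ z - y‖ ≤ ‖γ t - y‖ + ‖γ z - γ t‖ := by
    have := norm_add_le (γ t - y) (γ z - γ t)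
    rwa [add_comm (γ t - y), sub_add_sub_cancel] at this
  rw [slope_def_field, div_lt_iff₀ hh]
  have h4 : m * ‖γ z - y‖ ≤ m * ‖γ t - y‖ + m * (h * ‖v‖ + η * h) := by
    rw [← mul_add]
    gcongr
    linarith
  nlinarith

/-- Along a trajectory of a negative pseudo-gradient field, `φ` decreases at least `m` times as
fast as the trajectory moves. -/
theorem mul_dist_le_sub_of_trajectory (hφ : LocallyLipschitz φ) {L : ℝ≥0}
    (hX : LipschitzWith L X) (hm : 0 ≤ m)
    (hgrad : ∀ z, DifferentiableAt ℝ φ z → m * ‖X z‖ ≤ inner ℝ (X z) (gradient φ z))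
    (hγ : ∀ t, 0 ≤ t → HasDerivWithinAt γ (-X (γ t)) (Ici 0) t)
    {s t : ℝ} (hs : 0 ≤ s) (hst : s ≤ t) :
    m * dist (γ t) (γ s) ≤ φ (γ s) - φ (γ t) := by
  have hcont : ContinuousOn (fun z => φ (γ z) + m * ‖γ z - γ s‖) (Icc s t) := by
    have h1 : ContinuousOn γ (Icc s t) := fun z hz =>
      ((hγ z (hs.trans hz.1)).continuousWithinAt).mono fun w hw => hs.trans hw.1
    exact (hφ.continuous.comp_continuousOn h1).add
      (continuousOn_const.mul (h1.sub continuousOn_const).norm)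
  have := image_le_of_liminf_slope_right_le_deriv_boundary (B := fun _ => φ (γ s))
    (B' := fun _ => 0) hcont (by simp) continuousOn_const
    (fun z _ => hasDerivWithinAt_const _ _ _)
    (fun z hz r hr => (eventually_slope_lt_of_trajectory hφ hX hm hgrad
      ((hγ z (hs.trans hz.1)).mono (Ici_subset_Ici.2 (hs.trans hz.1))) (γ s) hr).frequently)
    (right_mem_Icc.2 hst)
  rw [dist_eq_norm]
  linarith

theorem mul_dist_le_abs_sub_of_trajectory (hφ : LocallyLipschitz φ) {L : ℝ≥0}
    (hX : LipschitzWith L X) (hm : 0 ≤ m)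
    (hgrad : ∀ z, DifferentiableAt ℝ φ z → m * ‖X z‖ ≤ inner ℝ (X z) (gradient φ z))
    (hγ : ∀ t, 0 ≤ t → HasDerivWithinAt γ (-X (γ t)) (Ici 0) t)
    {s t : ℝ} (hs : 0 ≤ s) (ht : 0 ≤ t) :
    m * dist (γ s) (γ t) ≤ |φ (γ s) - φ (γ t)| := by
  rcases le_total s t with h | h
  · rw [dist_comm]
    exact (mul_dist_le_sub_of_trajectory hφ hX hm hgrad hγ hs h).trans (le_abs_self _)
  · rw [abs_sub_comm]
    exact (mul_dist_le_sub_of_trajectory hφ hX hm hgrad hγ ht h).trans (le_abs_self _)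

/-- The trajectory of a negative pseudo-gradient field without zeros in `φ ⁻¹' (a, φ (γ 0)]`
descends below every level greater than `a`. -/
theorem exists_lt_of_trajectory (hφ : LocallyLipschitz φ) {L : ℝ≥0}
    (hX : LipschitzWith L X) (hm : 0 < m)
    (hgrad : ∀ z, DifferentiableAt ℝ φ z → m * ‖X z‖ ≤ inner ℝ (X z) (gradient φ z))
    (hγ : ∀ t, 0 ≤ t → HasDerivWithinAt γ (-X (γ t)) (Ici 0) t) {a l : ℝ}
    (hne : ∀ z, a < φ z → φ z ≤ φ (γ 0) → X z ≠ 0) (hl : a < l) :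
    ∃ t, 0 ≤ t ∧ φ (γ t) < l := by
  by_contra! hcon
  have : CompleteSpace E := FiniteDimensional.complete ℝ E
  have hanti : ∀ s t, 0 ≤ s → s ≤ t → φ (γ t) ≤ φ (γ s) := fun s t hs hst => by
    have := mul_dist_le_sub_of_trajectory hφ hX hm.le hgrad hγ hs hst
    linarith [mul_nonneg hm.le (dist_nonneg (x := γ t) (y := γ s))]
  have hlim : Tendsto (fun t => φ (γ (max t 0))) atTop
      (𝓝 (⨅ t, φ (γ (max t 0)))) :=
    tendsto_atTop_ciInf
      (fun s t hst => hanti _ _ (le_max_right _ _) (max_le_max_right 0 hst))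
      ⟨l, by
        rintro _ ⟨t, rfl⟩
        exact hcon _ (le_max_right _ _)⟩
  -- Bounded descent forces the trajectory to converge; its limit would be a zero of `X` above level
  -- `a`.
  have hcau : Cauchy (map (fun t => γ (max t 0)) atTop) := by
    rw [← CauchySeq, Metric.cauchySeq_iff]
    intro δ hδ
    obtain ⟨N, hN⟩ := Metric.cauchySeq_iff.1 hlim.cauchySeq (m * δ) (by positivity)
    refine ⟨N, fun s hs t ht => ?_⟩
    have h1 := hN s hs t ht
    rw [Real.dist_eq] at h1
    exact lt_of_mul_lt_mul_left ((mul_dist_le_abs_sub_of_trajectory hφ hX hm.le hgrad hγ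
      (le_max_right _ _) (le_max_right _ _)).trans_lt h1) hm.le
  obtain ⟨y, hy⟩ := cauchy_map_iff_exists_tendsto.1 hcau
  have hy' : Tendsto γ atTop (𝓝 y) := by
    refine hy.congr' ?_
    filter_upwards [eventually_ge_atTop 0] with t ht
    rw [max_eq_left ht]
  have hφy : Tendsto (fun t => φ (γ t)) atTop (𝓝 (φ y)) := (hφ.continuous.tendsto y).comp hy'
  have h0 : -X y = 0 := eq_zero_of_tendsto_trajectory hX.continuous.neg hγ hy'
  refine hne y (hl.trans_le (ge_of_tendsto hφy ?_)) (le_of_tendsto hφy ?_) (neg_eq_zero.1 h0)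
  · filter_upwards [eventually_ge_atTop 0] with t ht using hcon t ht
  · filter_upwards [eventually_ge_atTop 0] with t ht using hanti 0 t le_rfl ht

end Descent

/-! ### Points of a prescribed level -/

/-- Only approximation is claimed, as `l = a` may be reached only in the limit. The alternative `l =
φ (γ 0)` covers starting points already below `a`. -/
theorem exists_abs_sub_lt_of_level {α : Type*} {φ : α → ℝ} {γ : ℝ → α} {a l : ℝ}
    (hγ : ContinuousOn (fun t => φ (γ t)) (Ici 0))
    (hreach : ∀ l, a < l → ∃ t, 0 ≤ t ∧ φ (γ t) < l) (hal : a ≤ l ∨ l = φ (γ 0))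
    (hl : l ≤ φ (γ 0)) {δ : ℝ} (hδ : 0 < δ) :
    ∃ t, 0 ≤ t ∧ |l - φ (γ t)| < δ := by
  rcases hal with hal | rfl
  · obtain ⟨t, ht, hlt⟩ := hreach (l + δ) (by linarith)
    rcases le_total l (φ (γ t)) with h | h
    · exact ⟨t, ht, by rw [abs_lt]; constructor <;> linarith⟩
    · obtain ⟨s, hs, hsl⟩ := intermediate_value_Icc' ht (hγ.mono Icc_subset_Ici_self) ⟨h, hl⟩
      exact ⟨s, hs.1, by simpa [hsl] using hδ⟩
  · exact ⟨0, le_rfl, by simpa using hδ⟩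

/-- If `γ` moves at most `m⁻¹` times as fast as `φ` changes along it, then a level that is
approximated along `γ` is attained at a point that inherits this estimate. -/
theorem exists_point_of_level {α : Type*} [MetricSpace α] [CompleteSpace α] {φ : α → ℝ}
    {γ : ℝ → α} {m l : ℝ} (hφ : Continuous φ) (hm : 0 < m)
    (hγ : ∀ s t, 0 ≤ s → 0 ≤ t → m * dist (γ s) (γ t) ≤ |φ (γ s) - φ (γ t)|)
    (hl : ∀ δ > 0, ∃ t, 0 ≤ t ∧ |l - φ (γ t)| < δ) :
    ∃ p, φ p = l ∧ ∀ t, 0 ≤ t → m * dist p (γ t) ≤ |l - φ (γ t)| := by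
  choose u hu0 hu using fun n : ℕ => hl (1 / ((n : ℝ) + 1)) Nat.one_div_pos_of_nat
  have hlim : Tendsto (fun n => φ (γ (u n))) atTop (𝓝 l) := by
    rw [tendsto_iff_dist_tendsto_zero]
    refine squeeze_zero (fun _ => dist_nonneg) (fun n => ?_)
      tendsto_one_div_add_atTop_nhds_zero_nat
    rw [dist_comm]
    exact (hu n).le
  have hcau : CauchySeq fun n => γ (u n) := by
    rw [Metric.cauchySeq_iff]
    intro δ hδ
    obtain ⟨N, hN⟩ := Metric.cauchySeq_iff.1 hlim.cauchySeq (m * δ) (by positivity)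
    exact ⟨N, fun i hi j hj => lt_of_mul_lt_mul_left
      ((hγ _ _ (hu0 i) (hu0 j)).trans_lt (hN i hi j hj)) hm.le⟩
  obtain ⟨p, hp⟩ := cauchySeq_tendsto_of_complete hcau
  refine ⟨p, tendsto_nhds_unique ((hφ.tendsto p).comp hp) hlim, fun t ht => ?_⟩
  exact le_of_tendsto_of_tendsto ((hp.dist tendsto_const_nhds).const_mul m)
    (hlim.sub_const _).abs (Eventually.of_forall fun n => hγ _ _ (hu0 n) ht)

end ApproxFlow

/-! ### Construction of the deformation -/

open ApproxFlow in
theorem mainTheorem5 (d : ℕ) (a b : ℝ) (hab : a < b)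
    (φ : EuclideanSpace ℝ (Fin d) → ℝ) (hφ : LocallyLipschitz φ)
    (hφ' : ∃ k : NNReal, LipschitzOnWith k φ (closure (φ ⁻¹' Set.Ioc a b)))
    (μ : ℝ) (hμ : 0 < μ)
    (hclarke : ∀ x ∈ φ ⁻¹' Set.Ioc a b,
      μ ≤ ApproxFlow.distZero (ApproxFlow.clarkeGradient φ x))
    (ε : ℝ) (hε : 0 < ε) (hεμ : ε < μ) :
    ∃ C : C(unitInterval × ↥(φ ⁻¹' Set.Iic b), ↥(φ ⁻¹' Set.Iic b)),
      (∀ (s t : unitInterval) (x : ↥(φ ⁻¹' Set.Iic b)), t < s →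
        (C (s, x) : EuclideanSpace ℝ (Fin d)) ∈ φ ⁻¹' Set.Ioc a b →
        φ (C (s, x)) - φ (C (t, x)) ≤ -((s : ℝ) - (t : ℝ)) * (b - a)) ∧
      (∀ (t : unitInterval) (x : ↥(φ ⁻¹' Set.Iic b)), φ x ≤ a → C (t, x) = x) ∧
      (∀ x : ↥(φ ⁻¹' Set.Iic b),
        LipschitzWith (Real.toNNReal ((b - a) / (μ - ε))) (fun s => C (s, x))) ∧
      ApproxFlow.IsStrongDeformationRetraction {x : ↥(φ ⁻¹' Set.Iic b) | φ x ≤ a} C := by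
  have hm : 0 < μ - ε := sub_pos.2 hεμ
  set m := μ - ε with hm_def
  have hba : 0 < b - a := sub_pos.2 hab
  have hφc := hφ.continuous
  obtain ⟨X, hXL, hX1, hXne, hXgrad⟩ := exists_lipschitz_pseudoGradient hφ
    (S := φ ⁻¹' Set.Ioc a b) hm fun x hx =>
      exists_le_inner_gradient hφ hμ (sub_lt_self μ hε) (hclarke x hx)
  have hXL' : LipschitzWith 1 fun z => -X z := hXL.neg
  choose γ hγ0 hγ using fun x => exists_forward_trajectory (C := 1) hXL'
    (fun z => by rw [norm_neg]; exact hX1 z) x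
  have hγdist : ∀ x s t, 0 ≤ s → 0 ≤ t →
      m * dist (γ x s) (γ x t) ≤ |φ (γ x s) - φ (γ x t)| := fun x s t hs ht =>
    mul_dist_le_abs_sub_of_trajectory hφ hXL hm.le hXgrad (hγ x) hs ht
  have hγcont : ∀ t, 0 ≤ t → Continuous fun x => γ x t := fun t ht => by
    refine (LipschitzWith.of_dist_le_mul (K := ⟨Real.exp (1 * t), (Real.exp_pos _).le⟩)
      fun x y => ?_).continuous
    have := dist_forward_trajectory_le hXL' (hγ x) (hγ y) ht
    rw [hγ0, hγ0, mul_comm] at this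
    exact this
  -- Prescribed value of `φ` at the deformed point. The floor `min a (φ x)` stops the descent at `a`
  -- and freezes points already below.
  let level : unitInterval × ↥(φ ⁻¹' Set.Iic b) → ℝ := fun z =>
    max (φ z.2 - z.1 * (b - a)) (min a (φ z.2))
  have hlevel_cont : Continuous level := by fun_prop
  have hlevel_le : ∀ z : unitInterval × ↥(φ ⁻¹' Set.Iic b), level z ≤ φ z.2 := fun z =>
    max_le (sub_le_self _ (mul_nonneg z.1.2.1 hba.le)) (min_le_right _ _)
  have hlevel_fixed : ∀ z : unitInterval × ↥(φ ⁻¹' Set.Iic b), φ z.2 ≤ a →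
      level z = φ z.2 := fun z hz =>
    (hlevel_le z).antisymm (le_max_of_le_right (le_min hz le_rfl))
  have happrox : ∀ z : unitInterval × ↥(φ ⁻¹' Set.Iic b), ∀ δ > 0, ∃ t, 0 ≤ t ∧
      |level z - φ (γ z.2 t)| < δ := by
    intro z δ hδ
    refine exists_abs_sub_lt_of_level (a := a) (φ := φ)
      (hφc.comp_continuousOn fun t ht => (hγ z.2 t ht).continuousWithinAt) (fun l hl => ?_) ?_
      (by rw [hγ0]; exact hlevel_le z) hδ
    · refine exists_lt_of_trajectory hφ hXL hm hXgrad (hγ z.2) (fun y hay hy => ?_) hl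
      rw [hγ0] at hy
      exact hXne y ⟨hay, hy.trans z.2.2⟩
    · rw [hγ0]
      rcases le_total (φ z.2) a with h | h
      · exact Or.inr (hlevel_fixed z h)
      · exact Or.inl (le_max_of_le_right (le_min le_rfl h))
  choose P hPφ hP using fun z : unitInterval × ↥(φ ⁻¹' Set.Iic b) =>
    exists_point_of_level hφc hm (hγdist z.2) (happrox z)
  have hPcont : Continuous P := by
    rw [Metric.continuous_iff']
    intro z₀ δ hδ
    -- One fixed time `t` serves all `z` near `z₀`: both `P z` and `P z₀` are close to their
    -- trajectories at `t`, and the flow is continuous there.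
    obtain ⟨t, ht, hlt⟩ := happrox z₀ (m * (δ / 4)) (by positivity)
    have hγt : Continuous fun z : unitInterval × ↥(φ ⁻¹' Set.Iic b) => γ z.2 t :=
      (hγcont t ht).comp (continuous_subtype_val.comp continuous_snd)
    have h1 : ∀ᶠ z in 𝓝 z₀, |level z - φ (γ z.2 t)| < m * (δ / 4) :=
      (hlevel_cont.sub (hφc.comp hγt)).abs.continuousAt.eventually_lt_const hlt
    have h2 : ∀ᶠ z : unitInterval × ↥(φ ⁻¹' Set.Iic b) in 𝓝 z₀, dist (γ z.2 t) (γ z₀.2 t) < δ / 4 :=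
      hγt.continuousAt.eventually (Metric.ball_mem_nhds _ (by positivity))
    filter_upwards [h1, h2] with z hz1 hz2
    have h3 := lt_of_mul_lt_mul_left ((hP z t ht).trans_lt hz1) hm.le
    have h4 := lt_of_mul_lt_mul_left ((hP z₀ t ht).trans_lt hlt) hm.le
    have h5 := dist_triangle4 (P z) (γ z.2 t) (γ z₀.2 t) (P z₀)
    rw [dist_comm (γ z₀.2 t)] at h5
    linarith
  have hPdist : ∀ (s s' : unitInterval) (x : ↥(φ ⁻¹' Set.Iic b)),
      m * dist (P (s, x)) (P (s', x)) ≤ |level (s, x) - level (s', x)| := by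
    intro s s' x
    refine le_of_forall_pos_le_add fun δ hδ => ?_
    obtain ⟨t, ht, hlt⟩ := happrox (s', x) (δ / 2) (by positivity)
    have h1 := hP (s, x) t ht
    have h2 := hP (s', x) t ht
    have h3 := mul_le_mul_of_nonneg_left (dist_triangle_right (P (s, x)) (P (s', x)) (γ x t)) hm.le
    have h4 := abs_sub_le (level (s, x)) (level (s', x)) (φ (γ x t))
    rw [mul_add] at h3
    dsimp only at h1 h2 hlt
    linarith
  have hP0 : ∀ z : unitInterval × ↥(φ ⁻¹' Set.Iic b), level z = φ z.2 → P z = z.2 := by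
    intro z hz
    have h1 := hP z 0 le_rfl
    rw [hγ0, hz, sub_self, abs_zero] at h1
    exact dist_le_zero.1 (nonpos_of_mul_nonpos_right h1 hm)
  have hPb : ∀ z, P z ∈ φ ⁻¹' Set.Iic b := fun z => by
    rw [Set.mem_preimage, hPφ]
    exact (hlevel_le z).trans z.2.2
  let C : C(unitInterval × ↥(φ ⁻¹' Set.Iic b), ↥(φ ⁻¹' Set.Iic b)) :=
    ⟨fun z => ⟨P z, hPb z⟩, hPcont.subtype_mk hPb⟩
  have hfixed : ∀ (t : unitInterval) (x : ↥(φ ⁻¹' Set.Iic b)), φ x ≤ a → C (t, x) = x :=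
    fun t x hx => Subtype.ext (hP0 (t, x) (hlevel_fixed (t, x) hx))
  refine ⟨C, fun s t x _ hs => ?_, hfixed, fun x => ?_, ⟨fun x => ?_, fun x => ?_, hfixed⟩⟩
  · have hs' : a < level (s, x) := by
      have := hs.1
      rwa [← hPφ (s, x)]
    change φ (P (s, x)) - φ (P (t, x)) ≤ _
    rw [hPφ, hPφ]
    -- A level above `a` cannot come from the floor, so the linear branch is active at `s`; at `t`
    -- only its lower bound is needed.
    have h1 : level (s, x) = φ x - s * (b - a) :=
      max_eq_left (((lt_max_iff.1 hs').resolve_right (min_le_left _ _).not_gt).le.trans'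
        (min_le_left _ _))
    have h2 : φ x - t * (b - a) ≤ level (t, x) := le_max_left _ _
    rw [h1]
    linarith
  · refine LipschitzWith.of_dist_le_mul fun s s' => ?_
    change dist (P (s, x)) (P (s', x)) ≤ _
    rw [Real.coe_toNNReal _ (div_pos hba hm).le, div_mul_eq_mul_div, le_div_iff₀ hm, mul_comm]
    refine (hPdist s s' x).trans ((abs_max_sub_max_le_abs _ _ _).trans (le_of_eq ?_))
    dsimp only
    rw [sub_sub_sub_cancel_left, ← sub_mul, abs_mul, abs_of_pos hba, mul_comm, abs_sub_comm]
    rfl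
  · refine Subtype.ext (hP0 (0, x) ((hlevel_le _).antisymm (le_max_of_le_left ?_)))
    simp
  · change φ (P (1, x)) ≤ a
    rw [hPφ]
    refine max_le ?_ (min_le_left _ _)
    have : φ x ≤ b := x.2
    simp
    linarith
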